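/- Let \(\mathbb{K}\) be \(\mathbb{R}\) or \(\mathbb{C}\), let \((X,d)\) be a compact metric space and let \(E\) be a Banach space over \(\mathbb{K}\). Let \(\mathrm{lip}(X,E)\) be the space of all little Lipschitz functions \(f\colon X\to E\), that is, of all functions \(f\) with \(\mathcal{L}(f):=\sup_{x\ne x'}\|f(x)-f(x')\|_E/d(x,x')<\infty\) and \(\|f(x)-f(x')\|_E/d(x,x')\to 0\) as \(d(x,x')\to 0\), with the norm \(\|f\|_{\max}=\max\{\sup_{x\in X}\|f(x)\|_E,\ \mathcal{L}(f)\}\) (suprema over the empty set being \(0\)), and write \(\mathrm{lip}(X)=\mathrm{lip}(X,\mathbb{K})\). Assume that \(\mathrm{lip}(X)\) separates points uniformly: there is a constant \(c>1\) such that for all \(x\neq x'\) in \(X\) some \(f\in \mathrm{lip}(X)\) satisfies \(\mathcal{L}(f)\le c\) and \(|f(x)-f(x')|=d(x,x')\). For \(e^*\in E^*\) and \(h^*\in\mathrm{lip}(X)^*\) let \(e^*\otimes h^*\in\mathrm{lip}(X,E)^*\) be the functional \((e^*\otimes h^*)(f)=h^*(e^*\circ f)\), and for \(x\in X\) let \(\tau_x\in\mathrm{lip}(X)^*\),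 \(\tau_x(h)=h(x)\). Then the induced linear map from the algebraic tensor product \(E^*\otimes\mathrm{lip}(X)^*\) to \(\mathrm{lip}(X,E)^*\) is injective, so that \(E^*\otimes\mathrm{lip}(X)^*\) is a linear subspace of \(\mathrm{lip}(X,E)^*\), and this subspace is dense in \(\mathrm{lip}(X,E)^*\) for the dual norm. More precisely, already the linear span of the functionals \(e^*\otimes\tau_x\) \((e^*\in E^*,\ x\in X)\) is norm-dense in \(\mathrm{lip}(X,E)^*\). -/

import Mathlib

open scoped TensorProduct

noncomputable section

/-- `f` is little Lipschitz: it is Lipschitz, and `‖f x - f x'‖ / d(x, x') → 0`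
as `d(x, x') → 0` (with `x ≠ x'`). -/
def IsLittleLipschitz {X E : Type*} [MetricSpace X] [NormedAddCommGroup E] (f : X → E) : Prop :=
  (∃ C : NNReal, LipschitzWith C f) ∧
    ∀ ε : ℝ, 0 < ε → ∃ δ : ℝ, 0 < δ ∧ ∀ x x' : X, x ≠ x' → dist x x' < δ →
      ‖f x - f x'‖ / dist x x' < ε

/-- The Lipschitz constant `sup_{x ≠ x'} ‖f x - f x'‖ / d(x, x')`. It is a genuine supremum for
Lipschitz `f`, and `0` if `X` has at most one point. -/
def lipConst {X E : Type*} [MetricSpace X] [NormedAddCommGroup E] (f : X → E) : ℝ :=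
  ⨆ p : {p : X × X // p.1 ≠ p.2}, ‖f p.1.1 - f p.1.2‖ / dist p.1.1 p.1.2

section Aux

variable {X E : Type*} [MetricSpace X] [NormedAddCommGroup E]

theorem lipConst_nonneg (f : X → E) : 0 ≤ lipConst f :=
  Real.iSup_nonneg fun _ => div_nonneg (norm_nonneg _) dist_nonneg

theorem lipConst_le {f : X → E} {c : ℝ} (hc : 0 ≤ c)
    (h : ∀ x x', ‖f x - f x'‖ ≤ c * dist x x') : lipConst f ≤ c :=
  Real.iSup_le (fun _ => div_le_of_le_mul₀ dist_nonneg hc (h _ _)) hc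

theorem norm_sub_le_lipConst {f : X → E} (hf : ∃ C : NNReal, LipschitzWith C f) (x x' : X) :
    ‖f x - f x'‖ ≤ lipConst f * dist x x' := by
  obtain ⟨C, hC⟩ := hf
  rcases eq_or_ne x x' with rfl | hne
  · simp
  · have hb : BddAbove (Set.range fun p : {p : X × X // p.1 ≠ p.2} =>
        ‖f p.1.1 - f p.1.2‖ / dist p.1.1 p.1.2) := by
      refine ⟨C, ?_⟩
      rintro _ ⟨p, rfl⟩
      refine div_le_of_le_mul₀ dist_nonneg C.2 ?_
      rw [← dist_eq_norm]
      exact hC.dist_le_mul _ _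
    have h := le_ciSup hb ⟨(x, x'), hne⟩
    exact (div_le_iff₀ (dist_pos.2 hne)).1 h

theorem IsLittleLipschitz.zero : IsLittleLipschitz (0 : X → E) :=
  ⟨⟨0, LipschitzWith.const 0⟩, fun ε hε => ⟨1, one_pos, fun x x' _ _ => by simpa using hε⟩⟩

theorem IsLittleLipschitz.add {f g : X → E} (hf : IsLittleLipschitz f)
    (hg : IsLittleLipschitz g) : IsLittleLipschitz (f + g) := by
  obtain ⟨⟨C, hC⟩, hf⟩ := hf
  obtain ⟨⟨D, hD⟩, hg⟩ := hg
  refine ⟨⟨C + D, hC.add hD⟩, fun ε hε => ?_⟩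
  obtain ⟨δ, hδ, h1⟩ := hf (ε / 2) (half_pos hε)
  obtain ⟨η, hη, h2⟩ := hg (ε / 2) (half_pos hε)
  refine ⟨min δ η, lt_min hδ hη, fun x x' hne hd => ?_⟩
  have a := h1 x x' hne (hd.trans_le (min_le_left _ _))
  have b := h2 x x' hne (hd.trans_le (min_le_right _ _))
  have e : (f + g) x - (f + g) x' = (f x - f x') + (g x - g x') := by
    simp only [Pi.add_apply]; abel
  rw [e]
  calc _ ≤ (‖f x - f x'‖ + ‖g x - g x'‖) / dist x x' := by gcongr; exact norm_add_le _ _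
    _ < ε := by rw [add_div]; linarith

/-- Little Lipschitz functions are preserved by bounded linear operators. -/
theorem IsLittleLipschitz.clm {𝕜 F : Type*} [RCLike 𝕜] [NormedSpace 𝕜 E] [NormedAddCommGroup F]
    [NormedSpace 𝕜 F] (T : E →L[𝕜] F) {f : X → E} (hf : IsLittleLipschitz f) :
    IsLittleLipschitz (fun x => T (f x)) := by
  obtain ⟨⟨C, hC⟩, hf⟩ := hf
  refine ⟨⟨_, T.lipschitz.comp hC⟩, fun ε hε => ?_⟩
  have hT : 0 < ‖T‖ + 1 := by positivity
  obtain ⟨δ, hδ, h⟩ := hf (ε / (‖T‖ + 1)) (div_pos hε hT)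
  refine ⟨δ, hδ, fun x x' hne hd => ?_⟩
  have a := (lt_div_iff₀ hT).1 (h x x' hne hd)
  refine lt_of_le_of_lt ?_ a
  rw [← map_sub, div_mul_eq_mul_div]
  gcongr
  refine (T.le_opNorm _).trans ?_
  rw [mul_comm]
  gcongr
  linarith

end Aux

/-- The little Lipschitz functions as a linear subspace of `C(X, E)`. -/
def littleLipSubmodule (𝕜 X E : Type*) [RCLike 𝕜] [MetricSpace X] [NormedAddCommGroup E]
    [NormedSpace 𝕜 E] : Submodule 𝕜 C(X, E) where
  carrier := {f | IsLittleLipschitz f}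
  add_mem' hf hg := IsLittleLipschitz.add hf hg
  zero_mem' := IsLittleLipschitz.zero
  smul_mem' c _ hf := IsLittleLipschitz.clm (c • ContinuousLinearMap.id 𝕜 E) hf

/-- The space `lip(X, E)` of `E`-valued little Lipschitz functions on `X`. It is a type synonym of
the subspace of `C(X, E)` since it carries another norm, `max (‖f‖_∞) (lipConst f)`. -/
def LittleLip (𝕜 X E : Type*) [RCLike 𝕜] [MetricSpace X] [NormedAddCommGroup E]
    [NormedSpace 𝕜 E] : Type _ :=
  littleLipSubmodule 𝕜 X E

namespace LittleLip

section

variable {𝕜 X E : Type*} [RCLike 𝕜] [MetricSpace X] [NormedAddCommGroup E] [NormedSpace 𝕜 E]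

instance : AddCommGroup (LittleLip 𝕜 X E) :=
  inferInstanceAs (AddCommGroup (littleLipSubmodule 𝕜 X E))

instance : Module 𝕜 (LittleLip 𝕜 X E) :=
  inferInstanceAs (Module 𝕜 (littleLipSubmodule 𝕜 X E))

/-- The underlying continuous function. -/
def toCM (f : LittleLip 𝕜 X E) : C(X, E) := f.1

instance : CoeFun (LittleLip 𝕜 X E) fun _ => X → E := ⟨fun f => f.toCM⟩

theorem isLittleLipschitz (f : LittleLip 𝕜 X E) : IsLittleLipschitz (f : X → E) := f.2

theorem ext {f g : LittleLip 𝕜 X E} (h : ∀ x, f x = g x) : f = g :=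
  Subtype.ext (ContinuousMap.ext h)

@[simp] theorem add_apply (f g : LittleLip 𝕜 X E) (x : X) : (f + g) x = f x + g x := rfl

@[simp] theorem smul_apply (c : 𝕜) (f : LittleLip 𝕜 X E) (x : X) : (c • f) x = c • f x := rfl

@[simp] theorem zero_apply (x : X) : (0 : LittleLip 𝕜 X E) x = 0 := rfl

/-- The function `f` regarded as an element of `lip(X, E)`. -/
def mk (f : X → E) (hf : IsLittleLipschitz f) : LittleLip 𝕜 X E :=
  ⟨⟨f, hf.1.choose_spec.continuous⟩, hf⟩

@[simp] theorem mk_apply (f : X → E) (hf : IsLittleLipschitz f) (x : X) :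
    (mk f hf : LittleLip 𝕜 X E) x = f x := rfl

variable [CompactSpace X]

/-- The norm `‖f‖ = max (sup ‖f x‖) (lipConst f)`. -/
instance : Norm (LittleLip 𝕜 X E) := ⟨fun f => max ‖f.toCM‖ (lipConst (f : X → E))⟩

theorem norm_def (f : LittleLip 𝕜 X E) : ‖f‖ = max ‖f.toCM‖ (lipConst (f : X → E)) := rfl

theorem norm_nonneg' (f : LittleLip 𝕜 X E) : 0 ≤ ‖f‖ := le_max_of_le_left (norm_nonneg _)

theorem norm_apply_le (f : LittleLip 𝕜 X E) (x : X) : ‖f x‖ ≤ ‖f‖ :=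
  (f.toCM.norm_coe_le_norm x).trans (le_max_left _ _)

theorem norm_sub_le (f : LittleLip 𝕜 X E) (x x' : X) : ‖f x - f x'‖ ≤ ‖f‖ * dist x x' :=
  (norm_sub_le_lipConst f.isLittleLipschitz.1 x x').trans
    (mul_le_mul_of_nonneg_right (le_max_right _ _) dist_nonneg)

theorem norm_le' {f : LittleLip 𝕜 X E} {c : ℝ} (hc : 0 ≤ c) (h : ∀ x, ‖f x‖ ≤ c)
    (h' : ∀ x x', ‖f x - f x'‖ ≤ c * dist x x') : ‖f‖ ≤ c :=
  max_le ((ContinuousMap.norm_le _ hc).2 h) (lipConst_le hc h')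

theorem norm_smul_le' (c : 𝕜) (f : LittleLip 𝕜 X E) : ‖c • f‖ ≤ ‖c‖ * ‖f‖ := by
  refine norm_le' (mul_nonneg (norm_nonneg _) f.norm_nonneg') (fun x => ?_) fun x x' => ?_
  · rw [smul_apply, norm_smul]
    exact mul_le_mul_of_nonneg_left (f.norm_apply_le x) (norm_nonneg _)
  · rw [smul_apply, smul_apply, ← smul_sub, norm_smul, mul_assoc]
    exact mul_le_mul_of_nonneg_left (f.norm_sub_le x x') (norm_nonneg _)

theorem normedSpaceCore : NormedSpace.Core 𝕜 (LittleLip 𝕜 X E) where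
  norm_nonneg := norm_nonneg'
  norm_smul c f := by
    refine le_antisymm (norm_smul_le' c f) ?_
    rcases eq_or_ne c 0 with rfl | hc
    · simpa using norm_nonneg' _
    · have h := norm_smul_le' c⁻¹ (c • f)
      rw [inv_smul_smul₀ hc, norm_inv, ← div_eq_inv_mul, le_div_iff₀ (norm_pos_iff.2 hc)] at h
      rwa [mul_comm]
  norm_triangle f g := by
    refine norm_le' (add_nonneg f.norm_nonneg' g.norm_nonneg') (fun x => ?_) fun x x' => ?_
    · exact (norm_add_le _ _).trans (add_le_add (f.norm_apply_le x) (g.norm_apply_le x))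
    · rw [add_apply, add_apply, add_sub_add_comm, add_mul]
      exact (norm_add_le _ _).trans (add_le_add (f.norm_sub_le x x') (g.norm_sub_le x x'))
  norm_eq_zero_iff f := by
    refine ⟨fun h => ext fun x => ?_, ?_⟩
    · have := f.norm_apply_le x
      rw [h] at this
      simpa using this
    · rintro rfl
      exact le_antisymm (norm_le' le_rfl (by simp) (by simp)) (norm_nonneg' _)

instance : NormedAddCommGroup (LittleLip 𝕜 X E) := NormedAddCommGroup.ofCore normedSpaceCore

instance : NormedSpace 𝕜 (LittleLip 𝕜 X E) := NormedSpace.ofCore normedSpaceCore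

/-- The evaluation functional `τ_x ∈ lip(X)*`, `τ_x(h) = h(x)`. -/
def tau (x : X) : StrongDual 𝕜 (LittleLip 𝕜 X 𝕜) :=
  LinearMap.mkContinuous
    { toFun := fun h => h x
      map_add' := fun _ _ => rfl
      map_smul' := fun _ _ => rfl } 1
    fun h => (h.norm_apply_le x).trans (one_mul _).ge

@[simp] theorem tau_apply (x : X) (h : LittleLip 𝕜 X 𝕜) : tau x h = h x := rfl

/-- For `e* ∈ E*`, the bounded operator `f ↦ e* ∘ f` from `lip(X, E)` to `lip(X)`. -/
def dualComp (φ : StrongDual 𝕜 E) : LittleLip 𝕜 X E →L[𝕜] LittleLip 𝕜 X 𝕜 :=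
  LinearMap.mkContinuous
    { toFun := fun f => mk (fun x => φ (f x)) (f.isLittleLipschitz.clm φ)
      map_add' := fun f g => ext fun x => by simp
      map_smul' := fun c f => ext fun x => by simp } ‖φ‖
    fun f => by
      refine norm_le' (by positivity) (fun x => ?_) fun x x' => ?_
      · exact (φ.le_opNorm _).trans (mul_le_mul_of_nonneg_left (f.norm_apply_le x) (norm_nonneg _))
      · change ‖φ (f x) - φ (f x')‖ ≤ _
        rw [← map_sub, mul_assoc]
        exact (φ.le_opNorm _).trans (mul_le_mul_of_nonneg_left (f.norm_sub_le x x') (norm_nonneg _))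

@[simp] theorem dualComp_apply (φ : StrongDual 𝕜 E) (f : LittleLip 𝕜 X E) (x : X) :
    dualComp φ f x = φ (f x) := rfl

end

section

variable (𝕜 X E : Type*) [RCLike 𝕜] [MetricSpace X] [CompactSpace X] [NormedAddCommGroup E]
  [NormedSpace 𝕜 E]

/-- The canonical linear map from the algebraic tensor product `E* ⊗ lip(X)*` to `lip(X, E)*`,
given by `(e* ⊗ h*)(f) = h*(e* ∘ f)`. -/
def tensorToDual :
    StrongDual 𝕜 E ⊗[𝕜] StrongDual 𝕜 (LittleLip 𝕜 X 𝕜) →ₗ[𝕜] StrongDual 𝕜 (LittleLip 𝕜 X E) :=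
  TensorProduct.lift <|
    LinearMap.mk₂ 𝕜
      (fun (φ : StrongDual 𝕜 E) (ψ : StrongDual 𝕜 (LittleLip 𝕜 X 𝕜)) => ψ.comp (dualComp φ))
      (fun φ φ' ψ => ContinuousLinearMap.ext fun f => by
        change ψ (dualComp (φ + φ') f) = ψ (dualComp φ f) + ψ (dualComp φ' f)
        rw [← map_add]
        exact congrArg ψ (ext fun x => rfl))
      (fun c φ ψ => ContinuousLinearMap.ext fun f => by
        change ψ (dualComp (c • φ) f) = c • ψ (dualComp φ f)
        rw [← map_smul]
        exact congrArg ψ (ext fun x => rfl))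
      (fun _ _ _ => rfl)
      (fun _ _ _ => rfl)

@[simp] theorem tensorToDual_tmul_apply (φ : StrongDual 𝕜 E)
    (ψ : StrongDual 𝕜 (LittleLip 𝕜 X 𝕜)) (f : LittleLip 𝕜 X E) :
    tensorToDual 𝕜 X E (φ ⊗ₜ[𝕜] ψ) f = ψ (dualComp φ f) := rfl

end

/-- `lip(X)` separates points uniformly: there is `c > 1` such that for all `x ≠ x'` some
`f ∈ lip(X)` has Lipschitz constant at most `c` and `|f x - f x'| = d(x, x')`. -/
def SeparatesPointsUniformly (𝕜 X : Type*) [RCLike 𝕜] [MetricSpace X] : Prop :=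
  ∃ c : ℝ, 1 < c ∧ ∀ x x' : X, x ≠ x' →
    ∃ f : LittleLip 𝕜 X 𝕜, lipConst (f : X → 𝕜) ≤ c ∧ ‖f x - f x'‖ = dist x x'

end LittleLip

end

/-!
The proof has two independent parts, both of which work for an arbitrary range space `E`.

*Injectivity.* Expand a tensor along a basis of `E*`. Testing its image on the functions
`h(·) e` with `h ∈ lip(X)`, `e ∈ E`, and using the linear independence of the basis, shows that all
coefficients in `lip(X)*` vanish.

*Density.* The map `f ↦ (f, f̃)`, `f̃(x, x') = (f x - f x') / d(x, x')`, is an isometric embedding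
of `lip(X, E)` into `C(X, E) × C_b({x ≠ x'}, E)`, and the little Lipschitz condition says that `f̃`
is the uniform limit of its products with the cutoffs `χ_n = min 1 (n d)`. By Hahn–Banach a
functional on `lip(X, E)` extends to the product. Composing with the multiplication by `χ_n` changes
a functional on the elements approximated by their cutoffs by an arbitrarily small amount in norm
(`exists_norm_sub_comp_le`): this is the principle that the mass of a measure on a locally compact
space lives on compact sets, and it follows from the max-type norm. As `|χ_n f̃| ≤ 2 n sup |f|`, the
functionals bounded for the sup norm are dense in `lip(X, E)*` (`exists_supNorm_approx`). Such a
functional `G` on `C(X, E)` is approximated, through a fine partition of unity `(p_i)`, by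
`f ↦ G (∑ p_i f(x_i)) = ∑ e_i*(f(x_i))` with `e_i* = G(p_i ·)`, because
`sup |f - ∑ p_i f(x_i)| ≤ ε ‖f‖` on `lip(X, E)` (`exists_mem_span_norm_sub_le`).
-/

open scoped TensorProduct BoundedContinuousFunction
open Filter Topology

/-! ### Functionals and approximate cutoff operators -/

/-- If operators `P n` tend strongly to the identity and behave like multiplications by cutoffs for
a max-type norm, then every functional is approximated in norm by the functionals `F ∘ P n`. A
nearly norming vector `y` with `P n y` still nearly norming leaves no room for `F` on the vectors
`z - P n z`. -/
theorem exists_norm_sub_comp_le {𝕜 Y : Type*} [RCLike 𝕜] [NormedAddCommGroup Y] [NormedSpace 𝕜 Y]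
    (P : ℕ → Y →L[𝕜] Y) (hP : ∀ y, Tendsto (fun n => P n y) atTop (𝓝 y))
    (hmax : ∀ n y z, ‖P n y + (z - P n z)‖ ≤ max ‖y‖ ‖z‖)
    (F : StrongDual 𝕜 Y) {ε : ℝ} (hε : 0 < ε) :
    ∃ n, ∀ z, ‖F (z - P n z)‖ ≤ ε * ‖z‖ := by
  obtain ⟨y, hy, hFy⟩ := F.exists_lt_apply_of_lt_opNorm (sub_lt_self ‖F‖ hε)
  have hlim : Tendsto (fun n => ‖F (P n y)‖) atTop (𝓝 ‖F y‖) :=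
    ((F.continuous.tendsto y).comp (hP y)).norm
  obtain ⟨n, hn⟩ := (hlim.eventually (lt_mem_nhds hFy)).exists
  refine ⟨n, fun z => ?_⟩
  -- rotate both values of `F` to the positive half-line, so that they add up
  obtain ⟨c, hc, hc'⟩ := RCLike.exists_norm_eq_mul_self (F (P n y))
  obtain ⟨d, hd, hd'⟩ := RCLike.exists_norm_eq_mul_self (F (z - P n z))
  set r : 𝕜 := ((‖z‖ : ℝ) : 𝕜) with hr
  have hrn : ‖r‖ = ‖z‖ := by simp [hr]
  have key : F (P n (r • c • y) + (d • z - P n (d • z))) =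
      ((‖z‖ * ‖F (P n y)‖ + ‖F (z - P n z)‖ : ℝ) : 𝕜) := by
    have e : d • z - P n (d • z) = d • (z - P n z) := by rw [map_smul, smul_sub]
    rw [e, map_add, map_smul, map_smul, map_smul, map_smul, map_smul]
    rw [RCLike.ofReal_add, RCLike.ofReal_mul, hr]
    exact congrArg₂ (· + ·) (congrArg _ hc'.symm) hd'.symm
  have h1 : ‖P n (r • c • y) + (d • z - P n (d • z))‖ ≤ ‖z‖ := by
    refine (hmax n _ _).trans (max_le ?_ ?_)
    · rw [norm_smul, norm_smul, hrn, hc, one_mul]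
      exact mul_le_of_le_one_right (norm_nonneg _) hy.le
    · rw [norm_smul, hd, one_mul]
  have h2 := F.le_opNorm (P n (r • c • y) + (d • z - P n (d • z)))
  rw [key, RCLike.norm_ofReal, abs_of_nonneg (by positivity)] at h2
  nlinarith [mul_le_mul_of_nonneg_left h1 (norm_nonneg F),
    mul_le_mul_of_nonneg_left hn.le (norm_nonneg z)]

/-- The subspace of the vectors `y` with `P n y → y`. -/
def approxSubmodule {𝕜 Y : Type*} [RCLike 𝕜] [NormedAddCommGroup Y] [NormedSpace 𝕜 Y]
    (P : ℕ → Y →L[𝕜] Y) : Submodule 𝕜 Y where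
  carrier := {y | Tendsto (fun n => P n y) atTop (𝓝 y)}
  add_mem' {y z} hy hz := by
    simpa only [Set.mem_ofPred_eq, map_add] using Tendsto.add hy hz
  zero_mem' := by simp
  smul_mem' c y hy := by
    simpa only [Set.mem_ofPred_eq, map_smul] using Tendsto.const_smul hy c

/-- Version of `exists_norm_sub_comp_le` on the subspace where `P n` tends to the identity. -/
theorem exists_norm_sub_comp_le_of_commute {𝕜 Y : Type*} [RCLike 𝕜] [NormedAddCommGroup Y]
    [NormedSpace 𝕜 Y] (P : ℕ → Y →L[𝕜] Y) (hcomm : ∀ m n y, P m (P n y) = P n (P m y))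
    (hmax : ∀ n y z, ‖P n y + (z - P n z)‖ ≤ max ‖y‖ ‖z‖)
    (F : StrongDual 𝕜 Y) {ε : ℝ} (hε : 0 < ε) :
    ∃ n, ∀ z, Tendsto (fun m => P m z) atTop (𝓝 z) → ‖F (z - P n z)‖ ≤ ε * ‖z‖ := by
  have hmem : ∀ n (y : approxSubmodule P), P n y ∈ approxSubmodule P := fun n y => by
    have h := ((P n).continuous.tendsto _).comp y.2
    exact h.congr fun m => hcomm n m y
  obtain ⟨n, hn⟩ := exists_norm_sub_comp_le
    (fun n => ((P n).comp (approxSubmodule P).subtypeL).codRestrict (approxSubmodule P) (hmem n))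
    (fun y => tendsto_subtype_rng.2 y.2)
    (fun n y z => hmax n y z) (F.comp (approxSubmodule P).subtypeL) hε
  exact ⟨n, fun z hz => hn ⟨z, hz⟩⟩

namespace LittleLip

/-! ### The embedding by difference quotients -/

section Quotients

variable (𝕜 X E : Type*) [RCLike 𝕜] [MetricSpace X] [NormedAddCommGroup E] [NormedSpace 𝕜 E]

/-- The pairs of distinct points of `X`. -/
abbrev OffDiag (X : Type*) : Type _ := {p : X × X // p.1 ≠ p.2}

variable {X} in
/-- The cutoff `χ_n(x, x') = min 1 (n d(x, x'))`. Unlike an indicator function it is continuous,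
and `χ_n / d` is bounded. -/
noncomputable def cutoff (n : ℕ) (p : OffDiag X) : ℝ := min 1 (n * dist p.1.1 p.1.2)

variable {X}

theorem cutoff_nonneg (n : ℕ) (p : OffDiag X) : 0 ≤ cutoff n p :=
  le_min zero_le_one (by positivity)

theorem cutoff_le_one (n : ℕ) (p : OffDiag X) : cutoff n p ≤ 1 := min_le_left _ _

theorem dist_offDiag_pos (p : OffDiag X) : 0 < dist p.1.1 p.1.2 := dist_pos.2 p.2

theorem cutoff_div_dist_le (n : ℕ) (p : OffDiag X) : cutoff n p / dist p.1.1 p.1.2 ≤ n :=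
  (div_le_iff₀ (dist_offDiag_pos p)).2 (min_le_right _ _)

@[fun_prop]
theorem continuous_cutoff (n : ℕ) : Continuous (cutoff n : OffDiag X → ℝ) := by
  unfold cutoff
  fun_prop

variable (X)

/-- Multiplication by the cutoff `χ_n`. -/
noncomputable def cutoffMul (n : ℕ) : (OffDiag X →ᵇ E) →L[𝕜] (OffDiag X →ᵇ E) :=
  have hb (w : OffDiag X →ᵇ E) (p : OffDiag X) : ‖((cutoff n p : ℝ) : 𝕜) • w p‖ ≤ ‖w‖ := by
    rw [norm_smul, RCLike.norm_ofReal, abs_of_nonneg (cutoff_nonneg n p)]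
    exact (mul_le_of_le_one_left (norm_nonneg _) (cutoff_le_one n p)).trans (w.norm_coe_le_norm p)
  LinearMap.mkContinuous
    { toFun := fun w => BoundedContinuousFunction.ofNormedAddCommGroup
        (fun p => ((cutoff n p : ℝ) : 𝕜) • w p) (by fun_prop) ‖w‖ (hb w)
      map_add' := fun v w => by ext p; simp
      map_smul' := fun c w => by ext p; simp [smul_comm c] } 1
    fun w => by
      rw [one_mul]
      exact (BoundedContinuousFunction.norm_le (norm_nonneg _)).2 (hb w)

@[simp] theorem cutoffMul_apply (n : ℕ) (w : OffDiag X →ᵇ E) (p : OffDiag X) :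
    cutoffMul 𝕜 X E n w p = ((cutoff n p : ℝ) : 𝕜) • w p := rfl

/-- The operator `(g, w) ↦ (g, χ_n w)`. -/
noncomputable def cutoffProd (n : ℕ) :
    C(X, E) × (OffDiag X →ᵇ E) →L[𝕜] C(X, E) × (OffDiag X →ᵇ E) :=
  (ContinuousLinearMap.id 𝕜 C(X, E)).prodMap (cutoffMul 𝕜 X E n)

theorem cutoffProd_comm (m n : ℕ) (y : C(X, E) × (OffDiag X →ᵇ E)) :
    cutoffProd 𝕜 X E m (cutoffProd 𝕜 X E n y) = cutoffProd 𝕜 X E n (cutoffProd 𝕜 X E m y) := by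
  refine Prod.ext rfl (BoundedContinuousFunction.ext fun p => ?_)
  exact smul_comm _ _ _

variable [CompactSpace X]

/-- In each point, `χ_n y + (1 - χ_n) z` is a convex combination. -/
theorem norm_cutoffProd_add_le (n : ℕ) (y z : C(X, E) × (OffDiag X →ᵇ E)) :
    ‖cutoffProd 𝕜 X E n y + (z - cutoffProd 𝕜 X E n z)‖ ≤ max ‖y‖ ‖z‖ := by
  refine max_le ?_ ((BoundedContinuousFunction.norm_le (by positivity)).2 fun p => ?_)
  · have e : (cutoffProd 𝕜 X E n y + (z - cutoffProd 𝕜 X E n z)).1 = y.1 := by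
      simp [cutoffProd]
    rw [e]
    exact (norm_fst_le y).trans (le_max_left _ _)
  · have e : (cutoffProd 𝕜 X E n y + (z - cutoffProd 𝕜 X E n z)).2 p =
        ((cutoff n p : ℝ) : 𝕜) • y.2 p + ((1 - cutoff n p : ℝ) : 𝕜) • z.2 p := by
      simp [cutoffProd, sub_smul]
    have h0 := cutoff_nonneg n p
    have h1 := cutoff_le_one n p
    have hy : ‖y.2 p‖ ≤ max ‖y‖ ‖z‖ :=
      ((y.2.norm_coe_le_norm p).trans (norm_snd_le y)).trans (le_max_left _ _)
    have hz : ‖z.2 p‖ ≤ max ‖y‖ ‖z‖ :=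
      ((z.2.norm_coe_le_norm p).trans (norm_snd_le z)).trans (le_max_right _ _)
    rw [e]
    refine (norm_add_le _ _).trans ?_
    rw [norm_smul, norm_smul, RCLike.norm_ofReal, RCLike.norm_ofReal, abs_of_nonneg h0,
      abs_of_nonneg (sub_nonneg.2 h1)]
    nlinarith [mul_le_mul_of_nonneg_left hy h0,
      mul_le_mul_of_nonneg_left hz (sub_nonneg.2 h1)]

/-- The truncated difference quotients `g ↦ (g, χ_n g̃)`, which make sense on all of `C(X, E)`. -/
noncomputable def truncQuotient (n : ℕ) : C(X, E) →L[𝕜] C(X, E) × (OffDiag X →ᵇ E) :=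
  have hb (g : C(X, E)) (p : OffDiag X) :
      ‖((cutoff n p / dist p.1.1 p.1.2 : ℝ) : 𝕜) • (g p.1.1 - g p.1.2)‖ ≤ (n * 2) * ‖g‖ := by
    have h0 : 0 ≤ cutoff n p / dist p.1.1 p.1.2 := div_nonneg (cutoff_nonneg n p) dist_nonneg
    have h2 : ‖g p.1.1 - g p.1.2‖ ≤ 2 * ‖g‖ := by
      have a := g.norm_coe_le_norm p.1.1
      have b := g.norm_coe_le_norm p.1.2
      linarith [_root_.norm_sub_le (g p.1.1) (g p.1.2)]
    rw [norm_smul, RCLike.norm_ofReal, abs_of_nonneg h0, mul_assoc]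
    exact mul_le_mul (cutoff_div_dist_le n p) h2 (norm_nonneg _) (by positivity)
  (ContinuousLinearMap.id 𝕜 C(X, E)).prod <| LinearMap.mkContinuous
    { toFun := fun g => BoundedContinuousFunction.ofNormedAddCommGroup
        (fun p => ((cutoff n p / dist p.1.1 p.1.2 : ℝ) : 𝕜) • (g p.1.1 - g p.1.2))
        (by
          have hd : Continuous fun p : OffDiag X => cutoff n p / dist p.1.1 p.1.2 :=
            (continuous_cutoff n).div (by fun_prop) fun p => (dist_offDiag_pos p).ne'
          exact (RCLike.continuous_ofReal.comp hd).smul (by fun_prop)) _ (hb g)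
      map_add' := fun g h => by ext p; simp [add_sub_add_comm]
      map_smul' := fun c g => by ext p; simp [← smul_sub, smul_comm c] } (n * 2)
    fun g => (BoundedContinuousFunction.norm_le (by positivity)).2 (hb g)

theorem norm_quotient_le (f : LittleLip 𝕜 X E) (p : OffDiag X) :
    ‖((1 / dist p.1.1 p.1.2 : ℝ) : 𝕜) • (f p.1.1 - f p.1.2)‖ ≤ ‖f‖ := by
  have hd := dist_offDiag_pos p
  rw [norm_smul, RCLike.norm_ofReal, abs_of_nonneg (by positivity), one_div_mul_eq_div]
  exact (div_le_iff₀ hd).2 (f.norm_sub_le _ _)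

/-- The isometric embedding `f ↦ (f, f̃)`, where `f̃(x, x') = (f x - f x') / d(x, x')`. -/
noncomputable def quotientEmbedding : LittleLip 𝕜 X E →ₗᵢ[𝕜] C(X, E) × (OffDiag X →ᵇ E) where
  toFun f := (f.toCM, BoundedContinuousFunction.ofNormedAddCommGroup
    (fun p => ((1 / dist p.1.1 p.1.2 : ℝ) : 𝕜) • (f p.1.1 - f p.1.2))
    (by
      have hd : Continuous fun p : OffDiag X => 1 / dist p.1.1 p.1.2 :=
        continuous_const.div (by fun_prop) fun p => (dist_offDiag_pos p).ne'
      exact (RCLike.continuous_ofReal.comp hd).smul (by fun_prop))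
    ‖f‖ (norm_quotient_le 𝕜 X E f))
  map_add' f g := by
    refine Prod.ext rfl (BoundedContinuousFunction.ext fun p => ?_)
    simp [add_sub_add_comm]
  map_smul' c f := by
    refine Prod.ext rfl (BoundedContinuousFunction.ext fun p => ?_)
    simp [← smul_sub, smul_comm c]
  norm_map' f := by
    refine le_antisymm (max_le (le_max_left _ _)
      ((BoundedContinuousFunction.norm_le f.norm_nonneg').2 (norm_quotient_le 𝕜 X E f))) ?_
    refine max_le (le_max_left _ _) (Real.iSup_le (fun p => ?_) (norm_nonneg _))
    refine le_trans (le_of_eq ?_)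
      ((BoundedContinuousFunction.norm_coe_le_norm _ p).trans (le_max_right _ _))
    simp [norm_smul, div_eq_inv_mul]

theorem cutoffProd_quotientEmbedding (n : ℕ) (f : LittleLip 𝕜 X E) :
    cutoffProd 𝕜 X E n (quotientEmbedding 𝕜 X E f) = truncQuotient 𝕜 X E n f.toCM := by
  refine Prod.ext rfl (BoundedContinuousFunction.ext fun p => ?_)
  change ((cutoff n p : ℝ) : 𝕜) • ((1 / dist p.1.1 p.1.2 : ℝ) : 𝕜) • (f p.1.1 - f p.1.2) =
    ((cutoff n p / dist p.1.1 p.1.2 : ℝ) : 𝕜) • (f p.1.1 - f p.1.2)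
  rw [smul_smul, ← RCLike.ofReal_mul, mul_one_div]

/-- The little Lipschitz condition: the difference quotients are uniformly small where
`χ_n ≠ 1`. -/
theorem tendsto_cutoffProd_quotientEmbedding (f : LittleLip 𝕜 X E) :
    Tendsto (fun n => cutoffProd 𝕜 X E n (quotientEmbedding 𝕜 X E f)) atTop
      (𝓝 (quotientEmbedding 𝕜 X E f)) := by
  rw [Metric.tendsto_atTop]
  intro ε hε
  obtain ⟨δ, hδ, h⟩ := f.isLittleLipschitz.2 (ε / 2) (half_pos hε)
  obtain ⟨N, hN⟩ := exists_nat_gt (1 / δ)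
  refine ⟨N, fun n hn => ?_⟩
  rw [dist_eq_norm]
  refine lt_of_le_of_lt (max_le ?_
    ((BoundedContinuousFunction.norm_le (half_pos hε).le).2 fun p => ?_)) (half_lt_self hε)
  · simpa [cutoffProd] using (half_pos hε).le
  · have hd := dist_offDiag_pos p
    have e : (cutoffProd 𝕜 X E n (quotientEmbedding 𝕜 X E f) - quotientEmbedding 𝕜 X E f).2 p =
        ((cutoff n p - 1 : ℝ) : 𝕜) • ((1 / dist p.1.1 p.1.2 : ℝ) : 𝕜) • (f p.1.1 - f p.1.2) := by
      rw [RCLike.ofReal_sub, RCLike.ofReal_one, sub_smul, one_smul]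
      rfl
    rw [e, norm_smul, RCLike.norm_ofReal]
    rcases lt_or_ge (dist p.1.1 p.1.2) δ with hlt | hge
    · have h1 := (h _ _ p.2 hlt).le
      have h2 : |cutoff n p - 1| ≤ 1 :=
        abs_le.2 ⟨by linarith [cutoff_nonneg n p], by linarith [cutoff_le_one n p]⟩
      rw [norm_smul, RCLike.norm_ofReal, abs_of_nonneg (one_div_pos.2 hd).le, one_div_mul_eq_div]
      exact (mul_le_of_le_one_left (by positivity) h2).trans h1
    · have h1 : 1 ≤ n * dist p.1.1 p.1.2 := by
        have h3 : (N : ℝ) ≤ n := by exact_mod_cast hn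
        have h4 : 1 < N * δ := (div_lt_iff₀ hδ).1 hN
        calc (1 : ℝ) ≤ N * δ := h4.le
          _ ≤ _ := by gcongr
      rw [cutoff, min_eq_left h1]
      simpa using (half_pos hε).le

end Quotients

/-! ### Density -/

section Density

variable {𝕜 X E : Type*} [RCLike 𝕜] [MetricSpace X] [CompactSpace X] [NormedAddCommGroup E]
  [NormedSpace 𝕜 E]

/-- The functionals which are bounded for the supremum norm are dense in `lip(X, E)*`. -/
theorem exists_supNorm_approx (Φ : StrongDual 𝕜 (LittleLip 𝕜 X E)) {ε : ℝ} (hε : 0 < ε) :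
    ∃ G : StrongDual 𝕜 C(X, E), ∀ f : LittleLip 𝕜 X E, ‖Φ f - G f.toCM‖ ≤ ε * ‖f‖ := by
  let J := quotientEmbedding 𝕜 X E
  obtain ⟨F, hF, -⟩ := exists_extension_norm_eq (LinearMap.range J.toLinearMap)
    (Φ.comp J.equivRange.symm.toContinuousLinearEquiv.toContinuousLinearMap)
  have hFJ : ∀ f, F (J f) = Φ f := fun f => by
    refine (hF (J.equivRange f)).trans ?_
    simp
  obtain ⟨n, hn⟩ := exists_norm_sub_comp_le_of_commute (cutoffProd 𝕜 X E)
    (cutoffProd_comm 𝕜 X E) (norm_cutoffProd_add_le 𝕜 X E) F hε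
  refine ⟨F.comp (truncQuotient 𝕜 X E n), fun f => ?_⟩
  have h := hn (J f) (tendsto_cutoffProd_quotientEmbedding 𝕜 X E f)
  rwa [cutoffProd_quotientEmbedding, map_sub, hFJ, J.norm_map] at h

/-- The operator `e ↦ p(·) e` from `E` to `C(X, E)`, for a scalar function `p`. -/
noncomputable def smulConst (p : C(X, ℝ)) : E →L[𝕜] C(X, E) :=
  LinearMap.mkContinuous
    { toFun := fun e => ⟨fun x => ((p x : ℝ) : 𝕜) • e, by fun_prop⟩
      map_add' := fun e e' => by ext x; simp
      map_smul' := fun c e => by ext x; simp [smul_comm c] } ‖p‖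
    fun e => (ContinuousMap.norm_le _ (by positivity)).2 fun x => by
      change ‖((p x : ℝ) : 𝕜) • e‖ ≤ _
      rw [norm_smul, RCLike.norm_ofReal]
      exact mul_le_mul_of_nonneg_right (p.norm_coe_le_norm x) (norm_nonneg e)

@[simp] theorem smulConst_apply (p : C(X, ℝ)) (e : E) (x : X) :
    (smulConst (𝕜 := 𝕜) p e : C(X, E)) x = ((p x : ℝ) : 𝕜) • e := rfl

variable (X) in
/-- A finite partition of unity with supports in balls of radius `ε`. -/
theorem exists_partition_subordinate_balls {ε : ℝ} (hε : 0 < ε) :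
    ∃ (t : Finset X) (p : t → C(X, ℝ)), (∀ i x, 0 ≤ p i x) ∧ (∀ x, ∑ i, p i x = 1) ∧
      ∀ i x, p i x ≠ 0 → dist x i < ε := by
  obtain ⟨t, -, ht⟩ := (isCompact_univ (X := X)).elim_nhds_subcover (fun x => Metric.ball x ε)
    fun x _ => Metric.ball_mem_nhds x hε
  obtain ⟨p, hp⟩ := PartitionOfUnity.exists_isSubordinate isClosed_univ
    (fun i : t => Metric.ball (i : X) ε) (fun i => Metric.isOpen_ball)
    (fun x hx => by simpa using ht hx)
  refine ⟨t, p, fun i x => p.nonneg i x, fun x => ?_, fun i x hx => ?_⟩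
  · rw [← finsum_eq_sum_of_fintype]
    exact p.sum_eq_one (Set.mem_univ x)
  · exact hp i (subset_closure hx)

/-- Uniform approximation of `f ∈ lip(X, E)` by `∑ p_i f(x_i)`. -/
theorem norm_sub_sum_smulConst_le {ε : ℝ} (hε : 0 < ε) {t : Finset X} {p : t → C(X, ℝ)}
    (h0 : ∀ i x, 0 ≤ p i x) (h1 : ∀ x, ∑ i, p i x = 1)
    (hs : ∀ i x, p i x ≠ 0 → dist x i < ε) (f : LittleLip 𝕜 X E) :
    ‖f.toCM - ∑ i, smulConst (𝕜 := 𝕜) (p i) (f i)‖ ≤ ε * ‖f‖ := by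
  refine (ContinuousMap.norm_le _ (by positivity)).2 fun x => ?_
  have e : (f.toCM - ∑ i, smulConst (𝕜 := 𝕜) (p i) (f i)) x =
      ∑ i, ((p i x : ℝ) : 𝕜) • (f x - f i) := by
    simp only [smul_sub, Finset.sum_sub_distrib, ← Finset.sum_smul, ← RCLike.ofReal_sum, h1]
    simp
  rw [e]
  calc _ ≤ ∑ i, p i x * (ε * ‖f‖) := by
        refine norm_sum_le_of_le _ fun i _ => ?_
        rw [norm_smul, RCLike.norm_ofReal, abs_of_nonneg (h0 i x)]
        rcases eq_or_ne (p i x) 0 with hz | hz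
        · simp [hz]
        · refine mul_le_mul_of_nonneg_left ((f.norm_sub_le x i).trans ?_) (h0 i x)
          rw [mul_comm]
          exact mul_le_mul_of_nonneg_right (hs i x hz).le (norm_nonneg _)
    _ = ε * ‖f‖ := by rw [← Finset.sum_mul, h1, one_mul]

/-- A functional bounded for the supremum norm is close, in the norm of `lip(X, E)*`, to a
combination of functionals `e* ⊗ τ_x`. -/
theorem exists_mem_span_norm_sub_le (G : StrongDual 𝕜 C(X, E)) {ε : ℝ} (hε : 0 < ε) :
    ∃ Ψ ∈ Submodule.span 𝕜
      {F : StrongDual 𝕜 (LittleLip 𝕜 X E) | ∃ (φ : StrongDual 𝕜 E) (x : X),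
        F = tensorToDual 𝕜 X E (φ ⊗ₜ[𝕜] tau x)},
      ∀ f : LittleLip 𝕜 X E, ‖G f.toCM - Ψ f‖ ≤ ε * ‖f‖ := by
  obtain ⟨η, hη, hGη⟩ : ∃ η : ℝ, 0 < η ∧ ‖G‖ * η ≤ ε := by
    refine ⟨ε / (‖G‖ + 1), by positivity, ?_⟩
    rw [mul_div_assoc', div_le_iff₀ (by positivity)]
    nlinarith [norm_nonneg G]
  obtain ⟨t, p, h0, h1, hs⟩ := exists_partition_subordinate_balls X hη
  refine ⟨∑ i, tensorToDual 𝕜 X E ((G.comp (smulConst (p i))) ⊗ₜ[𝕜] tau (i : X)),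
    Submodule.sum_mem _ fun i _ => Submodule.subset_span ⟨_, _, rfl⟩, fun f => ?_⟩
  have e : G f.toCM - (∑ i, tensorToDual 𝕜 X E
      ((G.comp (smulConst (p i))) ⊗ₜ[𝕜] tau (i : X))) f =
      G (f.toCM - ∑ i, smulConst (𝕜 := 𝕜) (p i) (f i)) := by
    rw [map_sub, map_sum, sum_apply]
    simp
  rw [e]
  calc _ ≤ ‖G‖ * (η * ‖f‖) := G.le_opNorm_of_le (norm_sub_sum_smulConst_le hη h0 h1 hs f)
    _ ≤ ε * ‖f‖ := by
      rw [← mul_assoc]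
      exact mul_le_mul_of_nonneg_right hGη (norm_nonneg f)

variable (𝕜 X E) in
theorem dense_span_tmul_tau :
    Dense (Submodule.span 𝕜
      {F : StrongDual 𝕜 (LittleLip 𝕜 X E) | ∃ (φ : StrongDual 𝕜 E) (x : X),
        F = tensorToDual 𝕜 X E (φ ⊗ₜ[𝕜] tau x)} : Set (StrongDual 𝕜 (LittleLip 𝕜 X E))) := by
  refine Metric.dense_iff.2 fun Φ r hr => ?_
  have hr4 : 0 < r / 4 := by positivity
  obtain ⟨G, hG⟩ := exists_supNorm_approx Φ hr4
  obtain ⟨Ψ, hΨ, hGΨ⟩ := exists_mem_span_norm_sub_le G hr4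
  refine ⟨Ψ, ?_, hΨ⟩
  rw [mem_ball_iff_norm']
  refine lt_of_le_of_lt (ContinuousLinearMap.opNorm_le_bound _ (half_pos hr).le fun f => ?_)
    (half_lt_self hr)
  calc ‖(Φ - Ψ) f‖ = ‖(Φ f - G f.toCM) + (G f.toCM - Ψ f)‖ := by simp
    _ ≤ r / 4 * ‖f‖ + r / 4 * ‖f‖ := norm_add_le_of_le (hG f) (hGΨ f)
    _ = r / 2 * ‖f‖ := by ring

end Density

/-! ### Injectivity -/

section Injectivity

variable {𝕜 X E : Type*} [RCLike 𝕜] [MetricSpace X] [NormedAddCommGroup E] [NormedSpace 𝕜 E]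

/-- The elementary function `x ↦ h(x) e` in `lip(X, E)`. -/
noncomputable def smulRight (h : LittleLip 𝕜 X 𝕜) (e : E) : LittleLip 𝕜 X E :=
  mk (fun x => h x • e)
    (h.isLittleLipschitz.clm ((ContinuousLinearMap.id 𝕜 𝕜).smulRight e))

theorem dualComp_smulRight [CompactSpace X] (φ : StrongDual 𝕜 E) (h : LittleLip 𝕜 X 𝕜) (e : E) :
    dualComp φ (smulRight h e) = φ e • h :=
  ext fun x => by
    change φ (h x • e) = φ e • h x
    rw [map_smul, smul_eq_mul, smul_eq_mul, mul_comm]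

variable (𝕜 X E) in
theorem tensorToDual_injective [CompactSpace X] :
    Function.Injective (tensorToDual 𝕜 X E) := by
  rw [injective_iff_map_eq_zero]
  intro u hu
  let b := Module.Basis.ofVectorSpace 𝕜 (StrongDual 𝕜 E)
  obtain ⟨c, rfl⟩ := TensorProduct.eq_repr_basis_left b u
  suffices hc : c = 0 by simp [hc]
  ext i h
  -- the combination of the basis with the coefficients `c i h` vanishes on every `e`
  have hcomb : ∑ j ∈ c.support, c j h • b j = 0 := by
    ext e
    have := congrArg (fun Φ => Φ (smulRight h e)) hu
    simpa [Finsupp.sum, dualComp_smulRight, mul_comm] using this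
  by_cases hi : i ∈ c.support
  · exact linearIndependent_iff'.1 b.linearIndependent c.support (fun j => c j h) hcomb i hi
  · simp [Finsupp.notMem_support_iff.1 hi]

end Injectivity

end LittleLip

theorem proposition2p4 {𝕜 : Type*} [RCLike 𝕜] {X : Type*} [MetricSpace X] [CompactSpace X]
    {E : Type*} [NormedAddCommGroup E] [NormedSpace 𝕜 E] [CompleteSpace E]
    (hsep : LittleLip.SeparatesPointsUniformly 𝕜 X) :
    -- the algebraic tensor product `E* ⊗ lip(X)*` is a subspace of `lip(X, E)*`
    Function.Injective (LittleLip.tensorToDual 𝕜 X E) ∧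
    -- it is norm-dense
    DenseRange (LittleLip.tensorToDual 𝕜 X E) ∧
    -- the linear span of the functionals `e* ⊗ τ_x` is already norm-dense
    Dense (Submodule.span 𝕜
      {F : StrongDual 𝕜 (LittleLip 𝕜 X E) | ∃ (φ : StrongDual 𝕜 E) (x : X),
        F = LittleLip.tensorToDual 𝕜 X E (φ ⊗ₜ[𝕜] LittleLip.tau x)} :
      Set (StrongDual 𝕜 (LittleLip 𝕜 X E))) := by
  have hd := LittleLip.dense_span_tmul_tau 𝕜 X E
  refine ⟨LittleLip.tensorToDual_injective 𝕜 X E, ?_, hd⟩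
  refine hd.mono (SetLike.coe_subset_coe.2 (Submodule.span_le (p := LinearMap.range _).2 ?_))
  rintro _ ⟨φ, x, rfl⟩
  exact ⟨_, rfl⟩
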